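/- **Network.** There are $n$ users at arbitrary points of the unit square $[0,1]^2$ and a library of $m\ge 1$ independent, uniformly distributed files of $F$ bits. Every user can cache $M$ files ($MF$ bits). Under the protocol model with parameters $r,\Delta>0$, a set of simultaneous transmissions is successful if each receiver is within distance $r$ of its transmitter and at distance at least $(1+\Delta)r$ from all other transmitting users. Each file is split into $K$ equal packets and each user caches at most $MK$ packets. For a demand vector (one file index per user), each user transmits a message that is a function of its own cache and of the demand vector, and each user decodes its file from its cache, the demand vector and the messages it receives. The rate is the total number of transmitted bits divided by $F$. The rate $R$ is achievable with a given placement if for every $\varepsilon>0$ there is a sequence of such delivery schemes with $F\to\infty$ whose rates have upper limit at most $R$ and whose error probabilities, maximized over all demand vectors and users, have upper limit at most $\varepsilon$. **Graphs.** A graph is a $(\gamma,\tau)$-Ruzsa–Szemerédi graph if its edge set is the union of $\tau$ pairwise disjoint induced matchings, each of $\gamma$ edges. A graph on the set of users gives the following placement with $K=(2\gamma-1)n$: each vertex represents $2\gamma-1$ distinct packet labels, and a user caches, from every file, the packets represented by the vertices not adjacent to it (including itself). **Theorem.** Let $r\ge\sqrt2$, $\Delta>0$, and $n=\Lambda^z$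 with integers $\Lambda\ge2$ and $z\ge2\Lambda$. Let $$M\ \ge\ 2m\,n^{-\frac{1}{2\Lambda^4\ln\Lambda}},\qquad t=\frac{nM}{m}\in\mathbb Z^+ .$$ Then for some $\gamma\ge1$ and $\tau\ge0$ there is a $(\gamma,\tau)$-Ruzsa–Szemerédi graph on the $n$ users in which every vertex has degree at least $n-t$; and for every $\gamma\ge 1$, every $\tau\ge0$ and every such graph, the rate $$R^{\rm RS}(M)=\frac{\tau}{n}\cdot\frac{2\gamma}{2\gamma-1}$$ is achievable with $K=(2\gamma-1)n$ packets per file and the placement given by the graph. -/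

import Mathlib

open Filter

/-- `G` is a `(γ, τ)`-Ruzsa–Szemerédi graph: its edge set is the union of `τ` pairwise
(edge-)disjoint induced matchings, each consisting of `γ` edges. -/
def IsRuzsaSzemeredi {V : Type*} (G : SimpleGraph V) (γ τ : ℕ) : Prop :=
  ∃ N : Fin τ → G.Subgraph,
    (∀ j, (N j).IsMatching ∧ (N j).IsInduced ∧ (N j).edgeSet.ncard = γ) ∧
    (Pairwise fun i j => Disjoint (N i).edgeSet (N j).edgeSet) ∧
    ⋃ j, (N j).edgeSet = G.edgeSet

namespace D2D

/-- A packet of `b` bits. -/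
abbrev Packet (b : ℕ) : Type := Fin b → ZMod 2

/-- A file of `F = K * b` bits, split into `K` packets of `b` bits each. -/
abbrev File (K b : ℕ) : Type := Fin K → Packet b

/-- The demand vectors of `n` users on a library of `m` files. -/
abbrev Demand (n m : ℕ) : Type := Fin n → Fin m

/-- An uncoded packet placement: for each user `u`, the set of the cached packets; the pair
`(i, k)` stands for packet `k` of file `i`. -/
abbrev Placement (n m K : ℕ) : Type := Fin n → Finset (Fin m × Fin K)

/-- The protocol model with range `r` and guard parameter `Δ`: the pair `(u, v)` is the link on
which `u` transmits to `v`. A set of simultaneously active links is feasible if on each of them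
the receiver is within range `r` of its transmitter and at distance at least `(1 + Δ) r` from
every other transmitting user. -/
def FeasibleLinks {n : ℕ} (pos : Fin n → EuclideanSpace ℝ (Fin 2)) (r Δ : ℝ)
    (A : Finset (Fin n × Fin n)) : Prop :=
  ∀ l ∈ A, l.1 ≠ l.2 ∧ dist (pos l.1) (pos l.2) ≤ r ∧
    ∀ l' ∈ A, l'.1 ≠ l.1 → (1 + Δ) * r ≤ dist (pos l.2) (pos l'.1)

/-- The contents of the cache of user `u`, as a function of the library `W`. -/
def cacheContent {n m K b : ℕ} (Z : Placement n m K) (u : Fin n) (W : Fin m → File K b) :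
    Z u → Packet b :=
  fun p => W p.1.1 p.1.2

/-- A delivery scheme on top of the placement `Z`, for packets of `b` bits. The cache contents
`Z u → Packet b` are determined by the placement; everything a user sends is a function of its
own cache and of the demand vector. -/
structure DeliveryScheme {n m K : ℕ} (Z : Placement n m K) (b : ℕ) where
  /-- number of coded bits transmitted by each user -/
  len : Fin n → ℕ
  /-- node encoding functions -/
  encode : (u : Fin n) → (Z u → Packet b) → Demand n m → (Fin (len u) → ZMod 2)
  /-- transmission policy: the set of active links in each time slot -/
  active : ℕ → Finset (Fin n × Fin n)
  /-- node decoding functions; user `u` receives the message of user `v` if the link from `v` to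
  `u` is active in infinitely many slots, hence long enough for a message of any length -/
  decode : (u : Fin n) →
    ((v : {v : Fin n // ∃ᶠ s in atTop, (v, u) ∈ active s}) → Fin (len v.1) → ZMod 2) →
    (Z u → Packet b) → Demand n m → File K b

namespace DeliveryScheme

variable {n m K b : ℕ} {Z : Placement n m K}

/-- What user `u` decodes when the library is `W` and the demand vector is `f`. -/
def output (S : DeliveryScheme Z b) (W : Fin m → File K b) (f : Demand n m) (u : Fin n) :
    File K b :=
  S.decode u (fun v => S.encode v.1 (cacheContent Z v.1 W) f) (cacheContent Z u W) f

/-- Probability, over independent uniformly distributed files, that user `u` decodes its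
requested file incorrectly. -/
noncomputable def errorProb (S : DeliveryScheme Z b) (f : Demand n m) (u : Fin n) : ℝ :=
  (Nat.card {W : Fin m → File K b // S.output W f u ≠ W (f u)} : ℝ) /
    (Nat.card (Fin m → File K b) : ℝ)

/-- Worst-case error probability over all demand vectors and all users. -/
noncomputable def worstError (S : DeliveryScheme Z b) : ℝ :=
  ⨆ f : Demand n m, ⨆ u : Fin n, S.errorProb f u

/-- Transmission rate: total number of transmitted bits, divided by the file size. -/
noncomputable def rate (S : DeliveryScheme Z b) : ℝ :=
  (∑ u, (S.len u : ℝ)) / ((K * b : ℕ) : ℝ)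

end DeliveryScheme

/-- The cache-rate pair `(M, R)` is achievable, in the network with user positions `pos` under
the protocol model `(r, Δ)`, with `K` packets per file and the placement `Z`: no user caches
more than `M * K` packets (that is, `M` files), and for every `ε > 0` there is a sequence of
delivery schemes with file size `K * b s` tending to infinity, using feasible transmission
policies, whose rates have upper limit at most `R` and whose worst-case error probabilities have
upper limit at most `ε`. -/
def Achievable {n m : ℕ} (pos : Fin n → EuclideanSpace ℝ (Fin 2)) (r Δ : ℝ) (K : ℕ)
    (Z : Placement n m K) (M R : ℝ) : Prop :=
  (∀ u, ((Z u).card : ℝ) ≤ M * K) ∧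
  ∀ ε : ℝ, 0 < ε → ∃ (b : ℕ → ℕ) (S : (s : ℕ) → DeliveryScheme Z (b s)),
    Tendsto (fun s => K * b s) atTop atTop ∧
    (∀ s i, FeasibleLinks pos r Δ ((S s).active i)) ∧
    limsup (fun s => (((S s).rate : ℝ) : EReal)) atTop ≤ (R : EReal) ∧
    limsup (fun s => (((S s).worstError : ℝ) : EReal)) atTop ≤ (ε : EReal)

open Classical in
/-- The placement given by a graph on the users: each vertex represents `2 γ - 1` packet labels
out of `n * (2 γ - 1)`, and user `u` caches, from every file, the packets represented by the
vertices that are not adjacent to `u` (among them `u` itself). -/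
noncomputable def graphPlacement {n : ℕ} (m : ℕ) (G : SimpleGraph (Fin n)) (γ : ℕ) :
    Placement n m (n * (2 * γ - 1)) :=
  fun u => Finset.univ.filter fun p => ¬ G.Adj u (finProdFinEquiv.symm p.2).1

end D2D

/-! The existence claim is cheap: take the complete graph with single edges as matchings. The
substance is `achievable_graphPlacement`. A user lacks exactly the packets represented by its
neighbours, so each edge stands for two requests, one per endpoint, and every edge lies in some
matching. In an induced matching, a user is adjacent to its own partner but to no other vertex of
the matching (`not_adj_of_isInduced`). It therefore caches every packet wanted there by the others.
Each of the `2γ` users sends one sum of such packets; a receiver cancels all summands but its own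
and collects `2γ - 1` packets from the `2γ - 1` other senders. A matching costs `2γ` packets out of
`n(2γ - 1)` per file, which gives the rate. -/

/-! ### Matchings and labellings. -/

/-- In a matching the number of vertices is twice the number of edges. -/
theorem SimpleGraph.Subgraph.IsMatching.ncard_verts {V : Type*} [Finite V] {G : SimpleGraph V}
    {N : G.Subgraph} (h : N.IsMatching) : N.verts.ncard = 2 * N.edgeSet.ncard := by
  classical
  have := Fintype.ofFinite V
  -- The degrees form the indicator of `N.verts`, so the handshake lemma counts the vertices.
  have hdeg : ∀ v, N.spanningCoe.degree v = if v ∈ N.verts then 1 else 0 := by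
    intro v
    split_ifs with hv
    · obtain ⟨w, hw, huniq⟩ := h hv
      rw [← SimpleGraph.card_neighborFinset_eq_degree, Finset.card_eq_one]
      refine ⟨w, ?_⟩
      ext x
      simp only [SimpleGraph.mem_neighborFinset, SimpleGraph.Subgraph.spanningCoe_adj,
        Finset.mem_singleton]
      exact ⟨fun hx => huniq x hx, fun hx => hx ▸ hw⟩
    · rw [← SimpleGraph.card_neighborFinset_eq_degree, Finset.card_eq_zero]
      ext x
      simp only [SimpleGraph.mem_neighborFinset, SimpleGraph.Subgraph.spanningCoe_adj,
        Finset.notMem_empty, iff_false]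
      exact fun hx => hv hx.fst_mem
  have hsum := N.spanningCoe.sum_degrees_eq_twice_card_edges
  simp only [hdeg] at hsum
  rw [Finset.sum_boole, Nat.cast_id, ← Set.ncard_coe_finset, ← Set.ncard_coe_finset] at hsum
  simpa using hsum

/-- Every graph is the union of its edges, each of which is an induced matching. -/
theorem isRuzsaSzemeredi_one {V : Type*} [Finite V] (G : SimpleGraph V) :
    IsRuzsaSzemeredi G 1 G.edgeSet.ncard := by
  classical
  have hex : ∀ e : G.edgeSet, ∃ N : G.Subgraph,
      N.IsMatching ∧ N.IsInduced ∧ N.edgeSet = {e.1} := by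
    rintro ⟨e, he⟩
    induction e with
    | _ a b =>
      have hab : G.Adj a b := he
      refine ⟨G.subgraphOfAdj hab, SimpleGraph.Subgraph.IsMatching.subgraphOfAdj hab, ?_,
        SimpleGraph.edgeSet_subgraphOfAdj hab⟩
      intro v hv w hw hvw
      simp only [SimpleGraph.subgraphOfAdj_verts, Set.mem_insert_iff,
        Set.mem_singleton_iff] at hv hw
      have := hvw.ne
      simp only [SimpleGraph.subgraphOfAdj_adj, Sym2.eq_iff]
      grind
  choose N hM hI hE using hex
  let φ : Fin G.edgeSet.ncard ≃ G.edgeSet := (Finite.equivFin G.edgeSet).symm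
  refine ⟨fun j => N (φ j), fun j => ⟨hM _, hI _, by rw [hE, Set.ncard_singleton]⟩, ?_, ?_⟩
  · intro i j hij
    simp only [hE, Set.disjoint_singleton]
    exact fun h => hij (φ.injective (Subtype.ext h))
  · ext e
    simp only [hE, Set.mem_iUnion, Set.mem_singleton_iff]
    constructor
    · rintro ⟨j, rfl⟩
      exact (φ j).2
    · exact fun he => ⟨φ.symm ⟨e, he⟩, by simp⟩

/-- A finite set with at least `k` elements can be labelled with all elements of `Fin k`. -/
theorem Finset.exists_labelling {α : Type*} (s : Finset α) {k : ℕ} (hk : 0 < k)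
    (hs : k ≤ s.card) : ∃ g : α → Fin k, ∀ a, ∃ w ∈ s, g w = a := by
  obtain ⟨ι⟩ : Nonempty (Fin k ↪ s) :=
    Function.Embedding.nonempty_of_card_le (by simpa using hs)
  have : Nonempty (Fin k) := ⟨⟨0, hk⟩⟩
  have hinj : Function.Injective fun a => (ι a : α) :=
    Subtype.val_injective.comp ι.injective
  exact ⟨Function.invFun fun a => (ι a : α),
    fun a => ⟨ι a, (ι a).2, Function.leftInverse_invFun hinj a⟩⟩

/-! ### Broadcasting in the unit square. -/

namespace D2D

/-- Two points of the unit square are at distance at most `√2`. -/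
theorem dist_le_sqrt_two {x y : EuclideanSpace ℝ (Fin 2)}
    (hx : ∀ i, x i ∈ Set.Icc (0 : ℝ) 1) (hy : ∀ i, y i ∈ Set.Icc (0 : ℝ) 1) :
    dist x y ≤ √2 := by
  rw [EuclideanSpace.dist_eq]
  apply Real.sqrt_le_sqrt
  have h : ∀ i, dist (x i) (y i) ^ 2 ≤ 1 := by
    intro i
    rw [Real.dist_eq, sq_abs]
    obtain ⟨h1, h2⟩ := hx i
    obtain ⟨h3, h4⟩ := hy i
    nlinarith
  rw [Fin.sum_univ_two]
  linarith [h 0, h 1]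

/-- The links from a single transmitter to all other users. -/
def broadcastLinks {n : ℕ} (u : Fin n) : Finset (Fin n × Fin n) :=
  Finset.univ.filter fun l => l.1 = u ∧ l.2 ≠ u

/-- The range covers the diameter of the square, and with a single transmitter there is no
interference. -/
theorem feasibleLinks_broadcastLinks {n : ℕ} {pos : Fin n → EuclideanSpace ℝ (Fin 2)} {r : ℝ}
    (Δ : ℝ) (hpos : ∀ u i, pos u i ∈ Set.Icc (0 : ℝ) 1) (hr : √2 ≤ r) (u : Fin n) :
    FeasibleLinks pos r Δ (broadcastLinks u) := by
  rintro ⟨a, b⟩ hl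
  simp only [broadcastLinks, Finset.mem_filter, Finset.mem_univ, true_and] at hl
  obtain ⟨rfl, hb⟩ := hl
  refine ⟨hb.symm, (dist_le_sqrt_two (hpos _) (hpos _)).trans hr, ?_⟩
  rintro ⟨c, d⟩ hl' hne
  simp only [broadcastLinks, Finset.mem_filter, Finset.mem_univ, true_and] at hl'
  exact absurd hl'.1 hne

/-- The users take turns in transmitting to everyone else. -/
def roundRobin (n : ℕ) [NeZero n] (s : ℕ) : Finset (Fin n × Fin n) :=
  broadcastLinks (Fin.ofNat n s)

theorem frequently_mem_roundRobin {n : ℕ} [NeZero n] {u v : Fin n} (h : v ≠ u) :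
    ∃ᶠ s in atTop, (v, u) ∈ roundRobin n s := by
  rw [frequently_atTop]
  intro a
  -- This slot is congruent to `v` modulo `n`, and is at least `a` because `n ≥ 1`.
  refine ⟨v + n * a, ?_, ?_⟩
  · have := Nat.le_mul_of_pos_left a (NeZero.pos n)
    omega
  · have hv : Fin.ofNat n (v + n * a) = v := by
      ext
      simp [Fin.ofNat, Nat.mod_eq_of_lt v.isLt]
    exact Finset.mem_filter.2 ⟨Finset.mem_univ _, hv.symm, fun hu => h (hv.symm.trans hu.symm)⟩

section Determined

variable {n m K : ℕ} [NeZero n] {Z : Placement n m K} {L : Fin n → ℕ} {b : ℕ}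

open Classical in
/-- The scheme in which user `u` broadcasts the `L u` packets `enc u`, the users taking turns, and
every user decodes its file from any library that agrees with its cache and with the messages that
it receives. -/
noncomputable def broadcastScheme
    (enc : ∀ u, (Z u → Packet b) → Demand n m → Fin (L u) → Packet b) : DeliveryScheme Z b where
  len u := L u * b
  encode u c f := fun i => enc u c f (finProdFinEquiv.symm i).1 (finProdFinEquiv.symm i).2
  active := roundRobin n
  decode u μ c f :=
    if h : ∃ W : Fin m → File K b, cacheContent Z u W = c ∧
        ∀ v i, enc v.1 (cacheContent Z v.1 W) f (finProdFinEquiv.symm i).1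
          (finProdFinEquiv.symm i).2 = μ v i
    then h.choose (f u) else 0

/-- The true library is consistent with what `u` sees, so the default `0` is never used; `hdet`
makes every consistent library agree on the requested file. -/
theorem broadcastScheme_output
    {enc : ∀ u, (Z u → Packet b) → Demand n m → Fin (L u) → Packet b}
    (hdet : ∀ (f : Demand n m) (u : Fin n) (W W' : Fin m → File K b),
      cacheContent Z u W = cacheContent Z u W' →
      (∀ v, v ≠ u → enc v (cacheContent Z v W) f = enc v (cacheContent Z v W') f) →
      W (f u) = W' (f u))
    (W : Fin m → File K b) (f : Demand n m) (u : Fin n) :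
    (broadcastScheme enc).output W f u = W (f u) := by
  have h : ∃ W' : Fin m → File K b, cacheContent Z u W' = cacheContent Z u W ∧
      ∀ (v : {v : Fin n // ∃ᶠ s in atTop, (v, u) ∈ roundRobin n s}) (i : Fin (L v.1 * b)),
        enc v.1 (cacheContent Z v.1 W') f (finProdFinEquiv.symm i).1 (finProdFinEquiv.symm i).2 =
          enc v.1 (cacheContent Z v.1 W) f (finProdFinEquiv.symm i).1
            (finProdFinEquiv.symm i).2 :=
    ⟨W, rfl, fun _ _ => rfl⟩
  have hout : (broadcastScheme enc).output W f u = h.choose (f u) := dif_pos h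
  rw [hout]
  obtain ⟨hc, hmsg⟩ := h.choose_spec
  refine hdet f u _ W hc fun v hv => ?_
  funext a i
  simpa using hmsg ⟨v, frequently_mem_roundRobin hv⟩ (finProdFinEquiv (a, i))

end Determined

/-- If the users can broadcast `L u` packets each so that every user's file is determined by its
cache and by what the other users send, then the rate `(∑ u, L u) / K` is achievable. -/
theorem achievable_of_determined {n m K : ℕ} [NeZero n]
    {pos : Fin n → EuclideanSpace ℝ (Fin 2)} {r Δ M : ℝ}
    (hpos : ∀ u i, pos u i ∈ Set.Icc (0 : ℝ) 1) (hr : √2 ≤ r) (hK : 0 < K)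
    {Z : Placement n m K} (hZ : ∀ u, ((Z u).card : ℝ) ≤ M * K) {L : Fin n → ℕ}
    (enc : ∀ b u, (Z u → Packet b) → Demand n m → Fin (L u) → Packet b)
    (hdet : ∀ (b : ℕ) (f : Demand n m) (u : Fin n) (W W' : Fin m → File K b),
      cacheContent Z u W = cacheContent Z u W' →
      (∀ v, v ≠ u → enc b v (cacheContent Z v W) f = enc b v (cacheContent Z v W') f) →
      W (f u) = W' (f u)) :
    Achievable pos r Δ K Z M ((∑ u, (L u : ℝ)) / K) := by
  -- Packets of `s + 1` bits: the length is never zero, so it cancels in the rate.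
  refine ⟨hZ, fun ε hε => ⟨fun s => s + 1, fun s => broadcastScheme (enc (s + 1)), ?_, ?_, ?_, ?_⟩⟩
  · refine tendsto_atTop_mono (fun s => ?_) tendsto_id
    have := Nat.le_mul_of_pos_left (s + 1) hK
    simp only [id]
    omega
  · exact fun s i => feasibleLinks_broadcastLinks Δ hpos hr _
  · have hrate : ∀ s : ℕ,
        (broadcastScheme (enc (s + 1))).rate = (∑ u, (L u : ℝ)) / K := by
      intro s
      have hb : ((s : ℝ) + 1) ≠ 0 := by positivity
      simp only [DeliveryScheme.rate, broadcastScheme, Nat.cast_mul, ← Finset.sum_mul,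
        Nat.cast_add, Nat.cast_one]
      exact mul_div_mul_right _ _ hb
    simp only [hrate, limsup_const, le_refl]
  · have herr : ∀ s : ℕ, (broadcastScheme (enc (s + 1))).worstError = 0 := by
      intro s
      simp [DeliveryScheme.worstError, DeliveryScheme.errorProb,
        broadcastScheme_output (hdet (s + 1))]
    simp only [herr, limsup_const]
    exact_mod_cast hε.le

/-! ### Coded delivery for the graph placement. -/

open Classical in
/-- Reading a cached packet. -/
noncomputable def readPacket {n m K b : ℕ} {Z : Placement n m K} {u : Fin n}
    (c : Z u → Packet b) (p : Fin m × Fin K) : Packet b :=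
  if h : p ∈ Z u then c ⟨p, h⟩ else 0

theorem readPacket_cacheContent {n m K b : ℕ} {Z : Placement n m K} {u : Fin n}
    (W : Fin m → File K b) {p : Fin m × Fin K} (h : p ∈ Z u) :
    readPacket (cacheContent Z u W) p = W p.1 p.2 :=
  dif_pos h

theorem mem_graphPlacement {n m γ : ℕ} {G : SimpleGraph (Fin n)} {u v : Fin n} {i : Fin m}
    {a : Fin (2 * γ - 1)} :
    (i, finProdFinEquiv (v, a)) ∈ graphPlacement m G γ u ↔ ¬ G.Adj u v := by
  simp [graphPlacement]

theorem card_graphPlacement {n m γ : ℕ} (G : SimpleGraph (Fin n)) (u : Fin n) :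
    (graphPlacement m G γ u).card = m * ((n - (G.neighborSet u).ncard) * (2 * γ - 1)) := by
  classical
  have himg : graphPlacement m G γ u =
      (Finset.univ : Finset (Fin m)) ×ˢ
        (((G.neighborFinset u)ᶜ ×ˢ (Finset.univ : Finset (Fin (2 * γ - 1)))).map
          finProdFinEquiv.toEmbedding) := by
    ext ⟨i, k⟩
    obtain ⟨⟨v, a⟩, rfl⟩ := finProdFinEquiv.surjective k
    rw [mem_graphPlacement]
    simp only [Finset.mem_product, Finset.mem_univ, true_and]
    rw [← Equiv.coe_toEmbedding, Finset.mem_map']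
    simp
  have hcard : (G.neighborSet u).ncard = (G.neighborFinset u).card := by
    rw [← Set.ncard_coe_finset, SimpleGraph.coe_neighborFinset]
  rw [himg, Finset.card_product, Finset.card_map, Finset.card_product, Finset.card_compl, hcard]
  simp

/-- Vertices of an induced matching are not adjacent to each other's partners. -/
theorem not_adj_of_isInduced {V : Type*} {G : SimpleGraph V} {N : G.Subgraph}
    (hM : N.IsMatching) (hI : N.IsInduced) {u x y : V} (hu : u ∈ N.verts)
    (hxy : N.Adj x y) (hux : u ≠ x) : ¬ G.Adj u y := fun h =>
  -- By inducedness an edge `u y` would lie in `N`, giving `y` the two partners `u` and `x`.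
  hux ((hM hxy.snd_mem).unique (hI hu hxy.snd_mem h).symm hxy.symm)

open Classical in
/-- Coded delivery over the induced matchings of a Ruzsa–Szemerédi graph. In each matching, user
`w` sends the sum, over the other users `x` of the matching, of one of the packets represented by
the partner of `x` in the file requested by `x`. -/
theorem achievable_graphPlacement {n m γ τ : ℕ} [NeZero n]
    {pos : Fin n → EuclideanSpace ℝ (Fin 2)} {r Δ M : ℝ}
    (hpos : ∀ u i, pos u i ∈ Set.Icc (0 : ℝ) 1) (hr : √2 ≤ r) (hγ : 1 ≤ γ)
    {G : SimpleGraph (Fin n)} (hG : IsRuzsaSzemeredi G γ τ)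
    (hZ : ∀ u, ((graphPlacement m G γ u).card : ℝ) ≤ M * ((n * (2 * γ - 1) : ℕ) : ℝ)) :
    Achievable pos r Δ (n * (2 * γ - 1)) (graphPlacement m G γ) M
      ((τ : ℝ) / n * (2 * γ / (2 * γ - 1))) := by
  obtain ⟨N, hN, -, hU⟩ := hG
  have hγ' : 0 < 2 * γ - 1 := by omega
  have hcard : ∀ j, (Finset.univ.filter fun u => u ∈ (N j).verts).card = 2 * γ := by
    intro j
    rw [← (hN j).2.2, ← (hN j).1.ncard_verts, ← Set.ncard_coe_finset]
    simp
  have hpart : ∀ j u, ∃ v, u ∈ (N j).verts → (N j).Adj u v := by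
    intro j u
    by_cases hu : u ∈ (N j).verts
    · obtain ⟨v, hv, -⟩ := (hN j).1 hu
      exact ⟨v, fun _ => hv⟩
    · exact ⟨u, fun h => absurd h hu⟩
  choose p hp using hpart
  -- `g w` is the index of the packet that `w` delivers to `u`: the `2γ - 1` other users of the
  -- matching cover all `2γ - 1` labels of the partner of `u`.
  have hlabel : ∀ j u, ∃ g : Fin n → Fin (2 * γ - 1), u ∈ (N j).verts →
      ∀ a, ∃ w ∈ (Finset.univ.filter fun u => u ∈ (N j).verts).erase u, g w = a := by
    intro j u
    by_cases hu : u ∈ (N j).verts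
    · obtain ⟨g, hg⟩ := ((Finset.univ.filter fun u => u ∈ (N j).verts).erase u).exists_labelling
        hγ' (by rw [Finset.card_erase_of_mem (by simpa using hu), hcard])
      exact ⟨g, fun _ => hg⟩
    · exact ⟨fun _ => ⟨0, hγ'⟩, fun h => absurd h hu⟩
  choose g hg using hlabel
  let q : Demand n m → Fin τ → Fin n → Fin n → Fin m × Fin (n * (2 * γ - 1)) :=
    fun f j x w => (f x, finProdFinEquiv (p j x, g j x w))
  -- Used twice: a sender can form its sum, and a receiver can cancel the unwanted summands.
  have hq : ∀ f j x w u, u ∈ (N j).verts → x ∈ (N j).verts → u ≠ x →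
      q f j x w ∈ graphPlacement m G γ u := fun f j x w u hu hx hux =>
    mem_graphPlacement.2 (not_adj_of_isInduced (hN j).1 (hN j).2.1 hu (hp j x hx) hux)
  let J : Fin n → Finset (Fin τ) := fun u => Finset.univ.filter fun j => u ∈ (N j).verts
  let enc : ∀ (b : ℕ) (w : Fin n), (graphPlacement m G γ w → Packet b) → Demand n m →
      Fin (J w).card → Packet b := fun b w c f k =>
    ∑ x ∈ (Finset.univ.filter fun x => x ∈ (N ((J w).equivFin.symm k).1).verts).erase w,
      readPacket c (q f ((J w).equivFin.symm k).1 x w)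
  have hrate : (∑ u, ((J u).card : ℝ)) / ((n * (2 * γ - 1) : ℕ) : ℝ) =
      (τ : ℝ) / n * (2 * γ / (2 * γ - 1)) := by
    -- Double counting of incidences between users and matchings.
    have hsum : ∑ u, (J u).card = τ * (2 * γ) := by
      simp only [J, Finset.card_filter]
      rw [Finset.sum_comm]
      simp only [← Finset.card_filter, hcard]
      simp
    rw [← Nat.cast_sum, hsum, div_mul_div_comm]
    push_cast [show 1 ≤ 2 * γ by omega]
    ring
  rw [← hrate]
  refine achievable_of_determined hpos hr (Nat.mul_pos (NeZero.pos n) hγ') hZ enc ?_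
  intro b f u W W' hc hmsg
  have hcached : ∀ i ∈ graphPlacement m G γ u, W i.1 i.2 = W' i.1 i.2 := fun i hi =>
    congrFun hc ⟨i, hi⟩
  funext k
  obtain ⟨⟨v, a⟩, rfl⟩ := finProdFinEquiv.surjective k
  by_cases huv : G.Adj u v
  swap
  · exact hcached (f u, _) (mem_graphPlacement.2 huv)
  -- A missing packet belongs to a neighbour `v`; the matching containing the edge `u v` delivers
  -- it.
  obtain ⟨j, hj⟩ : ∃ j, s(u, v) ∈ (N j).edgeSet := by
    rw [← Set.mem_iUnion, hU]
    exact huv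
  have hj : (N j).Adj u v := hj
  have hu : u ∈ (N j).verts := hj.fst_mem
  have hpv : p j u = v := ((hN j).1 hu).unique (hp j u hu) hj
  obtain ⟨w, hw, hgw⟩ := hg j u hu a
  rw [Finset.mem_erase, Finset.mem_filter] at hw
  obtain ⟨hwu, -, hw⟩ := hw
  have hsent : ∀ W : Fin m → File (n * (2 * γ - 1)) b,
      enc b w (cacheContent _ w W) f ((J w).equivFin ⟨j, by simpa [J] using hw⟩) =
        ∑ x ∈ (Finset.univ.filter fun x => x ∈ (N j).verts).erase w,
          W (q f j x w).1 (q f j x w).2 := by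
    intro W
    simp only [enc, Equiv.symm_apply_apply]
    refine Finset.sum_congr rfl fun x hx => readPacket_cacheContent W ?_
    rw [Finset.mem_erase, Finset.mem_filter] at hx
    exact hq f j x w w hw hx.2.2 hx.1.symm
  have heq := congrFun (hmsg w hwu) ((J w).equivFin ⟨j, by simpa [J] using hw⟩)
  have hmem : u ∈ (Finset.univ.filter fun x => x ∈ (N j).verts).erase w := by
    simp [hu, hwu.symm]
  -- Both libraries give the same sum; apart from the term of `u`, all its terms are cached by `u`.
  rw [hsent, hsent, ← Finset.add_sum_erase _ _ hmem, ← Finset.add_sum_erase _ _ hmem] at heq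
  have hrest : ∀ x ∈ ((Finset.univ.filter fun x => x ∈ (N j).verts).erase w).erase u,
      W (q f j x w).1 (q f j x w).2 = W' (q f j x w).1 (q f j x w).2 := by
    intro x hx
    simp only [Finset.mem_erase, Finset.mem_filter, Finset.mem_univ, true_and] at hx
    exact hcached _ (hq f j x w u hu hx.2.2 hx.1.symm)
  rw [Finset.sum_congr rfl hrest] at heq
  simpa [q, hpv, hgw] using add_right_cancel heq

end D2D

theorem theorem3 (n m Λ z t : ℕ) (M r Δ : ℝ)
    (pos : Fin n → EuclideanSpace ℝ (Fin 2))
    (hpos : ∀ u i, pos u i ∈ Set.Icc (0 : ℝ) 1)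
    (hr : √2 ≤ r) (hΔ : 0 < Δ)
    (hm : 0 < m) (hΛ : 2 ≤ Λ) (hz : 2 * Λ ≤ z) (hn : n = Λ ^ z)
    (hM : 2 * (m : ℝ) * (n : ℝ) ^ (-(1 / (2 * (Λ : ℝ) ^ 4 * Real.log Λ))) ≤ M)
    (ht : (t : ℝ) = n * M / m) (ht0 : 0 < t) :
    (∃ (γ τ : ℕ) (G : SimpleGraph (Fin n)), 1 ≤ γ ∧ IsRuzsaSzemeredi G γ τ ∧
      ∀ u, n ≤ (G.neighborSet u).ncard + t) ∧
    ∀ (γ τ : ℕ) (G : SimpleGraph (Fin n)), 1 ≤ γ → IsRuzsaSzemeredi G γ τ →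
      (∀ u, n ≤ (G.neighborSet u).ncard + t) →
      D2D.Achievable pos r Δ (n * (2 * γ - 1)) (D2D.graphPlacement m G γ) M
        ((τ : ℝ) / n * (2 * γ / (2 * γ - 1))) := by
  have hn0 : 0 < n := hn ▸ pow_pos (by omega) z
  have : NeZero n := ⟨hn0.ne'⟩
  constructor
  -- All degrees are `n - 1`, which suffices since `t ≥ 1`.
  · refine ⟨1, _, ⊤, le_rfl, isRuzsaSzemeredi_one ⊤, fun u => ?_⟩
    have hnb : (⊤ : SimpleGraph (Fin n)).neighborSet u = {u}ᶜ := by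
      ext v
      simp [eq_comm]
    rw [hnb, Set.ncard_compl, Set.ncard_singleton, Nat.card_fin]
    omega
  · intro γ τ G hγ hG hdeg
    refine D2D.achievable_graphPlacement hpos hr hγ hG fun u => ?_
    -- At most `t` vertices are non-adjacent to `u`, and `m * t = n * M` turns this into the memory
    -- bound.
    have hle : m * ((n - (G.neighborSet u).ncard) * (2 * γ - 1)) ≤ m * (t * (2 * γ - 1)) := by
      have := hdeg u
      gcongr
      omega
    rw [D2D.card_graphPlacement]
    refine (Nat.cast_le.2 hle).trans_eq ?_
    have hm' : (m : ℝ) ≠ 0 := by positivity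
    rw [Nat.cast_mul, Nat.cast_mul, Nat.cast_mul, ht]
    field_simp
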